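/- Let $\Sigma$ be a finite alphabet and let $L \subseteq \Sigma^*$ be an indexed language, i.e. the language generated by an indexed grammar: one with finitely many nonterminals $N$ and indices $F$, a sentence symbol $S \in N$, and finitely many productions of the forms $A \to \alpha$, $A \to Bf$ and $Af \to \alpha$ with $A, B \in N$, $f \in F$, $\alpha \in (N \cup \Sigma)^*$. Derivations take place on sentential forms in $(NF^* \cup \Sigma)^*$: for every $\delta \in F^*$, the production $A \to \alpha$ replaces an occurrence of $A\delta$ by $\alpha\cdot\delta$, the production $A \to Bf$ replaces $A\delta$ by $Bf\delta$, and the production $Af \to \alpha$ replaces $Af\delta$ by $\alpha\cdot\delta$, where $\alpha\cdot\delta$ is obtained from $\alpha$ by appending $\delta$ to every nonterminal. For a word $w$, write $|w|$ for its length and $|w|_a$ for the number of occurrences of the letter $a$ in $w$. Then there is an integer constant $k > 0$ (depending only on $L$) such that for every $w \in L$ with $|w| > k$ there exists $v \in L$ with $\frac{1}{k}|w|_a \le |v|_a \le |w|_a$ for every $a \in \Sigma$, and $|v|_a < |w|_a$ for some $a \in \Sigma$. -/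

import Mathlib

/-- Productions of an indexed grammar with terminals `T`, nonterminals `N` and indices `F`. -/
inductive IndexedRule (T N F : Type*) where
  /-- `A → α` with `α ∈ (N ∪ T)*` -/
  | expand (A : N) (α : List (Symbol T N))
  /-- `A → B f` -/
  | push (A B : N) (f : F)
  /-- `A f → α` with `α ∈ (N ∪ T)*` -/
  | pop (A : N) (f : F) (α : List (Symbol T N))

/-- An indexed grammar over the terminal alphabet `T`: finitely many nonterminals, finitely many
indices, a sentence symbol, and a finite set of productions. -/
structure IndexedGrammar (T : Type*) where
  /-- The nonterminals. -/
  NT : Type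
  /-- The indices. -/
  Index : Type
  finite_NT : Finite NT
  finite_Index : Finite Index
  /-- The sentence symbol. -/
  initial : NT
  /-- The productions. -/
  rules : Finset (IndexedRule T NT Index)

/-- Sentential forms, the elements of `(N F* ∪ T)*`. A nonterminal carries its index string, whose
first entry is the index next to the nonterminal. -/
abbrev IndexedForm (T N F : Type*) := List (Symbol T (N × List F))

/-- `α · δ`: every nonterminal in `α` receives the index string `δ`; terminals receive none. -/
def IndexedForm.attach {T N F : Type*} (δ : List F) (α : List (Symbol T N)) :
    IndexedForm T N F :=
  α.map fun
    | .terminal a => .terminal a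
    | .nonterminal B => .nonterminal (B, δ)

/-- `r.Rewrites A δ γ`: the production `r` replaces the indexed nonterminal `A δ` by `γ`. -/
inductive IndexedRule.Rewrites {T N F : Type*} :
    IndexedRule T N F → N → List F → IndexedForm T N F → Prop
  | expand (A : N) (α : List (Symbol T N)) (δ : List F) :
      Rewrites (.expand A α) A δ (IndexedForm.attach δ α)
  | push (A B : N) (f : F) (δ : List F) :
      Rewrites (.push A B f) A δ [.nonterminal (B, f :: δ)]
  | pop (A : N) (f : F) (α : List (Symbol T N)) (δ : List F) :
      Rewrites (.pop A f α) A (f :: δ) (IndexedForm.attach δ α)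

namespace IndexedGrammar

variable {T : Type*}

/-- One derivation step. -/
def Produces (g : IndexedGrammar T) (u v : IndexedForm T g.NT g.Index) : Prop :=
  ∃ r ∈ g.rules, ∃ (A : g.NT) (δ : List g.Index) (γ p q : IndexedForm T g.NT g.Index),
    r.Rewrites A δ γ ∧ u = p ++ [.nonterminal (A, δ)] ++ q ∧ v = p ++ γ ++ q

/-- Derivation in any finite number of steps. -/
def Derives (g : IndexedGrammar T) :
    IndexedForm T g.NT g.Index → IndexedForm T g.NT g.Index → Prop :=
  Relation.ReflTransGen g.Produces

/-- The terminal words derivable from the sentence symbol with empty index string. -/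
def language (g : IndexedGrammar T) : Language T :=
  {w : List T | g.Derives [.nonterminal (g.initial, [])] (w.map .terminal)}

end IndexedGrammar

/-- A language is indexed if some indexed grammar generates it. -/
def Language.IsIndexed {T : Type*} (L : Language T) : Prop :=
  ∃ g : IndexedGrammar T, g.language = L

/-! Letter counts ignore order, so derivations are replaced by the relation `Yields` on multisets of
symbols. By Dickson's lemma there is a single `B` such that any `m` symbols of a member of `{t |
g.Yields f {x} t}` lie in a sub-multiset of size at most `B` that is again a member
(`exists_card_bound_extension`); `m` is the number of letters.

Induction on derivations (`Yields.exists_decomposition`) shows that what one symbol yields either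
has at most `B` elements of nonzero weight or is `Shrinkable` with at most `K = C * B + B * B`
parts. One rule takes the count from at most `B` to at most `K`; in that range single elements serve
as parts (`Shrinkable.of_extension`), and beyond it the parts are inherited from a subderivation.

In a long word, keeping for each letter a part richest in it costs at most a factor `K + 1`, while
losing a nonzero part makes the word strictly smaller (`Shrinkable.exists_count_le`). -/

namespace Multiset

/-! ### Dickson's lemma for multisets -/

theorem exists_le_map_eq_of_le_map {α β : Type*} (f : α → β) {s : Multiset β} {w : Multiset α}
    (h : s ≤ w.map f) : ∃ v ≤ w, v.map f = s := by
  induction s using Multiset.induction generalizing w with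
  | empty => exact ⟨0, zero_le _, rfl⟩
  | cons b s ih =>
    obtain ⟨y, hy, rfl⟩ := mem_map.1 (mem_of_le h (mem_cons_self b s))
    obtain ⟨w', rfl⟩ := exists_cons_of_mem hy
    rw [map_cons, cons_le_cons_iff] at h
    obtain ⟨v, hv, rfl⟩ := ih h
    exact ⟨y ::ₘ v, (cons_le_cons_iff y).2 hv, map_cons _ _ _⟩

theorem finite_card_le (α : Type*) [Finite α] (m : ℕ) : {s : Multiset α | card s ≤ m}.Finite := by
  classical
  have := Fintype.ofFinite α
  refine (Set.finite_Icc 0 (m • (Finset.univ : Finset α).val)).subset fun s hs => ⟨zero_le _, ?_⟩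
  refine le_iff_count.2 fun a => ?_
  rw [count_nsmul, count_eq_one_of_mem Finset.univ.nodup (Finset.mem_univ a), mul_one]
  exact (count_le_card a s).trans hs

instance wellQuasiOrderedLE {α : Type*} [Finite α] : WellQuasiOrderedLE (Multiset α) := by
  classical
  exact (Finsupp.orderIsoMultiset (ι := α)).wellQuasiOrderedLE_iff.1 inferInstance

/-- Every member of a set of multisets over a finite type contains one of bounded size. -/
theorem exists_card_bound {α : Type*} [Finite α] (S : Set (Multiset α)) :
    ∃ K, ∀ s ∈ S, ∃ t ∈ S, t ≤ s ∧ card t ≤ K := by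
  have hfin : {t | Minimal (· ∈ S) t}.Finite :=
    WellQuasiOrderedLE.finite_of_isAntichain (setOfPred_minimal_antichain _)
  obtain ⟨K, hK⟩ := (hfin.image card).bddAbove
  refine ⟨K, fun s hs => ?_⟩
  obtain ⟨t, hts, ht⟩ := (Set.isPWO_of_wellQuasiOrderedLE S).exists_le_minimal hs
  exact ⟨t, ht.1, hts, hK ⟨t, ht, rfl⟩⟩

/-- In finitely many sets of multisets over a finite type, every sub-multiset of size at most `m`
of a member extends, inside that member, to a member of bounded size. -/
theorem exists_card_bound_extension {α ι : Type*} [Finite α] [Finite ι]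
    (S : ι → Set (Multiset α)) (m : ℕ) :
    ∃ K, ∀ i, ∀ s ∈ S i, ∀ d ≤ s, card d ≤ m → ∃ t ∈ S i, d ≤ t ∧ t ≤ s ∧ card t ≤ K := by
  -- For fixed `i` and `d`, the minimal complements `r` with `d + r ∈ S i` have bounded size, and
  -- only finitely many pairs `(i, d)` occur.
  choose B hB using fun p : ι × Multiset α => exists_card_bound {s | p.2 + s ∈ S p.1}
  obtain ⟨K, hK⟩ := ((Set.finite_univ.prod (finite_card_le α m)).image B).bddAbove
  refine ⟨m + K, fun i s hs d hd hm => ?_⟩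
  obtain ⟨r, rfl⟩ := exists_add_of_le hd
  obtain ⟨t, ht, htr, htc⟩ := hB (i, d) r hs
  refine ⟨d + t, ht, Multiset.le_add_right _ _, add_le_add_right htr _, ?_⟩
  rw [card_add]
  exact add_le_add hm (htc.trans (hK ⟨(i, d), ⟨trivial, hm⟩, rfl⟩))

theorem sum_filter_ne_zero {M : Type*} [AddCommMonoid M] [DecidableEq M] (s : Multiset M) :
    (s.filter (· ≠ 0)).sum = s.sum := by
  induction s using Multiset.induction with
  | empty => rfl
  | cons a s ih =>
    by_cases h : a = 0
    · rw [filter_cons_of_neg (p := (· ≠ 0)) s (by simpa using h), ih, sum_cons, h, zero_add]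
    · rw [filter_cons_of_pos (p := (· ≠ 0)) s h, sum_cons, sum_cons, ih]

theorem le_card_mul_of_forall_mem_le {s : Multiset ℕ} {b : ℕ} (h : ∀ x ∈ s, x ≤ b) :
    s.sum ≤ card s * b := by
  simpa using sum_le_card_nsmul s b h

end Multiset

/-! ### Shrinkable labelled multisets -/

open Multiset in
/-- The labelled multiset `w` splits into a core of weight `p` and at most `K` further parts of
nonzero weights `P`, such that any `m` of the parts lie, together with the core, in a labelled
sub-multiset of `w` which represents an element of `L` and misses a part. -/
def Shrinkable {X Y V : Type*} [AddCommMonoid V] (m K : ℕ) (L : Set (Multiset X)) (π : Y → X)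
    (wt : Y → V) (w : Multiset Y) : Prop :=
  ∃ (p : V) (P : Multiset V), card P ≤ K ∧ 0 ∉ P ∧ p + P.sum = (w.map wt).sum ∧
    ∀ J ≤ P, card J ≤ m → ∃ I, J ≤ I ∧ I < P ∧
      ∃ v ≤ w, v.map π ∈ L ∧ (v.map wt).sum = p + I.sum

/-- The number of elements of nonzero weight. -/
noncomputable def weightCount {Y V : Type*} [AddCommMonoid V] (wt : Y → V) (w : Multiset Y) : ℕ :=
  open Classical in ((w.map wt).filter (· ≠ 0)).card

section Shrinkable

open Multiset

variable {X Y V : Type*} [AddCommMonoid V] {m K : ℕ} {L L' : Set (Multiset X)} {π : Y → X}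
  {wt : Y → V}

theorem weightCount_add (v w : Multiset Y) :
    weightCount wt (v + w) = weightCount wt v + weightCount wt w := by
  simp [weightCount]

theorem weightCount_le_card (w : Multiset Y) : weightCount wt w ≤ card w := by
  classical
  exact (card_le_card (filter_le _ _)).trans (card_map _ _).le

theorem weightCount_eq_card {w : Multiset Y} (h : ∀ y ∈ w, wt y ≠ 0) :
    weightCount wt w = card w := by
  classical
  rw [weightCount, filter_eq_self.2, card_map]
  simpa using h

theorem weightCount_eq_zero_of_sum_eq_zero [PartialOrder V] [CanonicallyOrderedAdd V]
    [IsOrderedAddMonoid V]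
    {w : Multiset Y} (h : (w.map wt).sum = 0) : weightCount wt w = 0 := by
  classical
  rw [weightCount, card_eq_zero, filter_eq_nil]
  intro x hx
  simpa using sum_eq_zero_iff.1 h x hx

theorem Shrinkable.mono {w : Multiset Y} (h : Shrinkable m K L π wt w) (hL : L ⊆ L') :
    Shrinkable m K L' π wt w := by
  obtain ⟨p, P, hK, h0, hs, h⟩ := h
  refine ⟨p, P, hK, h0, hs, fun J hJ hm => ?_⟩
  obtain ⟨I, hJI, hI, v, hv, hvL, hvs⟩ := h J hJ hm
  exact ⟨I, hJI, hI, v, hv, hL hvL, hvs⟩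

/-- The added elements are never dropped: their weight joins the core. -/
theorem Shrinkable.add_right {w c : Multiset Y} (h : Shrinkable m K L π wt w)
    (hL : ∀ v ∈ L, v + c.map π ∈ L') : Shrinkable m K L' π wt (w + c) := by
  obtain ⟨p, P, hK, h0, hs, h⟩ := h
  refine ⟨p + (c.map wt).sum, P, hK, h0, ?_, fun J hJ hm => ?_⟩
  · rw [Multiset.map_add, sum_add, ← hs, add_right_comm]
  · obtain ⟨I, hJI, hI, v, hv, hvL, hvs⟩ := h J hJ hm
    refine ⟨I, hJI, hI, v + c, by gcongr, ?_, ?_⟩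
    · rw [Multiset.map_add]; exact hL _ hvL
    · rw [Multiset.map_add, sum_add, hvs, add_right_comm]

/-- Each element of `w` stands for a whole block of elements of `Y` and weighs as much as its block,
so the same core and parts serve after the blocks are substituted. -/
theorem Shrinkable.sum_snd {Z : Type*} {w : Multiset (Z × Multiset Y)} {L₀ : Set (Multiset Z)}
    (h : Shrinkable m K L₀ Prod.fst (fun q => (q.2.map wt).sum) w)
    (hL : ∀ v ≤ w, v.map Prod.fst ∈ L₀ → ((v.map Prod.snd).sum).map π ∈ L) :
    Shrinkable m K L π wt (w.map Prod.snd).sum := by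
  have key (v : Multiset (Z × Multiset Y)) :
      ((v.map Prod.snd).sum.map wt).sum = (v.map fun q => (q.2.map wt).sum).sum := by
    induction v using Multiset.induction with
    | empty => rfl
    | cons a s ih => simp only [map_cons, sum_cons, Multiset.map_add, sum_add, ih]
  obtain ⟨p, P, hK, h0, hs, h⟩ := h
  refine ⟨p, P, hK, h0, hs.trans (key w).symm, fun J hJ hm => ?_⟩
  obtain ⟨I, hJI, hI, v, hv, hvL, hvs⟩ := h J hJ hm
  refine ⟨I, hJI, hI, (v.map Prod.snd).sum, ?_, hL v hv hvL, (key v).trans hvs⟩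
  obtain ⟨u, rfl⟩ := exists_add_of_le hv
  rw [Multiset.map_add, sum_add]
  exact Multiset.le_add_right _ _

/-- A set in which small sub-multisets of members extend to members of size less than the
number of elements of nonzero weight in `w`: here the parts are single elements. -/
theorem Shrinkable.of_extension {w : Multiset Y} {B : ℕ} (hw : w.map π ∈ L)
    (hL : ∀ s ∈ L, ∀ d ≤ s, card d ≤ m → ∃ t ∈ L, d ≤ t ∧ t ≤ s ∧ card t ≤ B)
    (hB : B < weightCount wt w) (hK : weightCount wt w ≤ K) : Shrinkable m K L π wt w := by
  classical
  refine ⟨0, (w.map wt).filter (· ≠ 0), hK, fun h => (mem_filter.1 h).2 rfl, ?_, ?_⟩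
  · rw [zero_add, sum_filter_ne_zero]
  intro J hJ hm
  obtain ⟨d, hd, rfl⟩ := exists_le_map_eq_of_le_map wt (hJ.trans (filter_le _ _))
  obtain ⟨c, rfl⟩ := exists_add_of_le hd
  obtain ⟨t, htL, hdt, hts, htB⟩ := hL _ hw _ (map_le_map hd) (by simpa using hm)
  obtain ⟨r, rfl⟩ := exists_add_of_le hdt
  rw [Multiset.map_add, Multiset.add_le_add_iff_left] at hts
  obtain ⟨e, he, rfl⟩ := exists_le_map_eq_of_le_map π hts
  have hle : ((d + e).map wt).filter (· ≠ 0) ≤ ((d + c).map wt).filter (· ≠ 0) :=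
    filter_le_filter _ (map_le_map (by gcongr))
  refine ⟨((d + e).map wt).filter (· ≠ 0), ?_, lt_of_le_of_ne hle ?_, d + e, by gcongr, ?_, ?_⟩
  · rw [← filter_eq_self.2 fun x hx => (mem_filter.1 (mem_of_le hJ hx)).2]
    exact filter_le_filter _ (map_le_map (Multiset.le_add_right _ _))
  -- At most `B` elements are kept, fewer than there are elements of nonzero weight, so some part is
  -- missed.
  · intro h
    have h1 : weightCount wt (d + e) = weightCount wt (d + c) := congrArg card h
    have h2 := weightCount_le_card (wt := wt) (d + e)
    rw [← Multiset.map_add, card_map] at htB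
    omega
  · rwa [Multiset.map_add]
  · rw [zero_add, sum_filter_ne_zero]

end Shrinkable
-- Derivations on multisets and their decomposition
namespace IndexedGrammar

variable {T : Type*} {g : IndexedGrammar T}

/-- `g.Yields f s t`: if every nonterminal of `s` carries the index string `f δ`, then rewriting
until every `f` has been consumed leads to `t`, whose nonterminals carry `δ`. Symbols are counted
without regard to their order, and `none` stands for an empty index string. -/
inductive Yields (g : IndexedGrammar T) :
    Option g.Index → Multiset (Symbol T g.NT) → Multiset (Symbol T g.NT) → Prop
  | zero (f) : Yields g f 0 0
  | terminal (f) (a : T) : Yields g f {.terminal a} {.terminal a}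
  | add {f s₁ s₂ t₁ t₂} : Yields g f s₁ t₁ → Yields g f s₂ t₂ → Yields g f (s₁ + s₂) (t₁ + t₂)
  | expand {f A t} {α : List (Symbol T g.NT)} : .expand A α ∈ g.rules →
      Yields g f α t → Yields g f {.nonterminal A} t
  | push {f A B i s t} : .push A B i ∈ g.rules →
      Yields g (some i) {.nonterminal B} s → Yields g f s t → Yields g f {.nonterminal A} t
  | pop {A i} {α : List (Symbol T g.NT)} : .pop A i α ∈ g.rules →
      Yields g (some i) {.nonterminal A} α

section Shrinking

open Multiset

theorem Yields.sum_snd {Y : Type*} {π : Y → Symbol T g.NT} {f : Option g.Index}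
    (w : Multiset (Symbol T g.NT × Multiset Y)) (h : ∀ q ∈ w, g.Yields f {q.1} (q.2.map π)) :
    g.Yields f (w.map Prod.fst) ((w.map Prod.snd).sum.map π) := by
  induction w using Multiset.induction with
  | empty => exact .zero f
  | cons q w ih =>
    rw [map_cons, map_cons, sum_cons, Multiset.map_add, ← singleton_add]
    exact (h q (mem_cons_self _ _)).add (ih fun q' hq' => h q' (mem_cons_of_mem hq'))

/-- One shrinkable block suffices, since all others can go into the core. Otherwise every block is
small, and blocks of total weight zero contribute nothing to the count. -/
theorem shrinkable_or_weightCount_le {Y V : Type*} [AddCommMonoid V] [PartialOrder V]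
    [CanonicallyOrderedAdd V] [IsOrderedAddMonoid V] {m K B : ℕ} {π : Y → Symbol T g.NT}
    {wt : Y → V} {f : Option g.Index} (w : Multiset (Symbol T g.NT × Multiset Y))
    (h : ∀ q ∈ w, g.Yields f {q.1} (q.2.map π) ∧ (weightCount wt q.2 ≤ B ∨
      Shrinkable m K {t | g.Yields f {q.1} t} π wt q.2)) :
    Shrinkable m K {t | g.Yields f (w.map Prod.fst) t} π wt (w.map Prod.snd).sum ∨
      weightCount wt (w.map Prod.snd).sum ≤
        weightCount (fun q : Symbol T g.NT × Multiset Y => (q.2.map wt).sum) w * B := by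
  induction w using Multiset.induction with
  | empty => right; simp [weightCount]
  | cons q w ih =>
    have hw := fun q' hq' => h q' (mem_cons_of_mem hq')
    obtain ⟨hy, hq⟩ := h q (mem_cons_self _ _)
    rw [map_cons, map_cons, sum_cons, ← singleton_add, ← singleton_add, weightCount_add,
      weightCount_add]
    rcases hq with hq | hq
    · rcases ih hw with ih | ih
      · left
        rw [add_comm q.2]
        refine ih.add_right fun v hv => ?_
        have := hy.add hv
        rwa [add_comm (q.2.map π)] at this
      · right
        rw [add_mul]
        refine add_le_add ?_ ih
        by_cases h0 : (q.2.map wt).sum = 0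
        · simp [weightCount_eq_zero_of_sum_eq_zero h0]
        · rw [weightCount.eq_1 _ {q}, map_singleton, filter_singleton, if_pos h0, card_singleton,
            one_mul]
          exact hq
    · left
      exact hq.add_right fun v hv => Yields.add hv (Yields.sum_snd w fun q' hq' => (hw q' hq').1)

/-- If `B` bounds the extensions of `m` symbols to an element, and `K` is large enough, then in a
result of rewriting any symbols, the part that comes from each of them is shrinkable or small. -/
theorem Yields.exists_decomposition.{u} {T V : Type u} [AddCommMonoid V] [PartialOrder V]
    [CanonicallyOrderedAdd V] [IsOrderedAddMonoid V] {g : IndexedGrammar T} {m B C : ℕ}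
    (hB : ∀ (f : Option g.Index) (x : Symbol T g.NT), ∀ s, g.Yields f {x} s → ∀ d ≤ s,
      card d ≤ m → ∃ t, g.Yields f {x} t ∧ d ≤ t ∧ t ≤ s ∧ card t ≤ B)
    (hB1 : 1 ≤ B)
    (hCe : ∀ A α, .expand A α ∈ g.rules → α.length ≤ C)
    (hCp : ∀ A i α, .pop A i α ∈ g.rules → α.length ≤ C)
    {f : Option g.Index} {s t : Multiset (Symbol T g.NT)} (h : g.Yields f s t) :
    ∀ {Y : Type u} (π : Y → Symbol T g.NT) (wt : Y → V) (w : Multiset Y), w.map π = t →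
      ∃ w₀ : Multiset (Symbol T g.NT × Multiset Y), w₀.map Prod.fst = s ∧
        (w₀.map Prod.snd).sum = w ∧ ∀ q ∈ w₀, g.Yields f {q.1} (q.2.map π) ∧
          (weightCount wt q.2 ≤ B ∨
            Shrinkable m (C * B + B * B) {t | g.Yields f {q.1} t} π wt q.2) := by
  -- A count above `B` but at most `K` is covered by `Shrinkable.of_extension`, so each rule only
  -- has to keep the count at most `K`.
  have single {f : Option g.Index} {x : Symbol T g.NT} {Y : Type u} {π : Y → Symbol T g.NT}
      {wt : Y → V} {w : Multiset Y} (hy : g.Yields f {x} (w.map π))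
      (hw : Shrinkable m (C * B + B * B) {t | g.Yields f {x} t} π wt w ∨
        weightCount wt w ≤ C * B + B * B) :
      ∃ w₀ : Multiset (Symbol T g.NT × Multiset Y), w₀.map Prod.fst = {x} ∧
        (w₀.map Prod.snd).sum = w ∧ ∀ q ∈ w₀, g.Yields f {q.1} (q.2.map π) ∧
          (weightCount wt q.2 ≤ B ∨
            Shrinkable m (C * B + B * B) {t | g.Yields f {q.1} t} π wt q.2) := by
    refine ⟨{(x, w)}, by simp, by simp, fun q hq => ?_⟩
    rw [mem_singleton.1 hq]
    refine ⟨hy, or_iff_not_imp_left.2 fun hlt => ?_⟩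
    rcases hw with hw | hw
    · exact hw
    · exact .of_extension hy (hB f x) (not_le.1 hlt) hw
  induction h with
  | zero f =>
    intro Y π wt w hw
    refine ⟨0, rfl, ?_, by simp⟩
    rw [map_eq_zero.1 hw]; rfl
  | terminal f a =>
    intro Y π wt w hw
    refine single (by rw [hw]; exact .terminal f a) (.inr ?_)
    have h1 := weightCount_le_card (wt := wt) w
    rw [← card_map π, hw, card_singleton] at h1
    nlinarith
  | @add f s₁ s₂ t₁ t₂ h₁ h₂ ih₁ ih₂ =>
    intro Y π wt w hw
    obtain ⟨v, hv, rfl⟩ := exists_le_map_eq_of_le_map π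
      ((Multiset.le_add_right t₁ t₂).trans hw.ge)
    obtain ⟨c, rfl⟩ := exists_add_of_le hv
    obtain ⟨w₁, rfl, hs₁, hq₁⟩ := ih₁ π wt v rfl
    obtain ⟨w₂, rfl, hs₂, hq₂⟩ := ih₂ π wt c (by simpa [Multiset.map_add] using hw)
    refine ⟨w₁ + w₂, Multiset.map_add _ _ _, by rw [Multiset.map_add, sum_add, hs₁, hs₂], ?_⟩
    intro q hq
    exact (mem_add.1 hq).elim (hq₁ q) (hq₂ q)
  | @expand f A t α hr h ih =>
    intro Y π wt w hw
    obtain ⟨w₀, hf, rfl, hq⟩ := ih π wt w hw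
    refine single (by rw [hw]; exact .expand hr h) ?_
    refine (shrinkable_or_weightCount_le w₀ hq).imp (fun h => h.mono ?_) fun h => h.trans ?_
    · rw [hf]; exact fun t ht => .expand hr ht
    · have h1 := weightCount_le_card
        (wt := fun q : Symbol T g.NT × Multiset Y => (q.2.map wt).sum) w₀
      rw [← card_map Prod.fst, hf, coe_card] at h1
      have h2 := h1.trans (hCe A α hr)
      exact (Nat.mul_le_mul_right B h2).trans (Nat.le_add_right _ _)
  | @push f A B' i s t hr h₁ h₂ ih₁ ih₂ =>
    intro Y π wt w hw
    obtain ⟨w₀, rfl, rfl, hq⟩ := ih₂ π wt w hw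
    -- The first derivation is decomposed with new labels: each intermediate symbol carries the
    -- block it later yields and weighs as much. Hence the induction must allow every label type
    -- `Y`.
    obtain ⟨w₁, hf, rfl, hq₁⟩ :=
      ih₁ Prod.fst (fun q : Symbol T g.NT × Multiset Y => (q.2.map wt).sum) w₀ rfl
    refine single (by rw [hw]; exact .push hr h₁ h₂) ?_
    obtain ⟨⟨x, c⟩, rfl, rfl⟩ := map_eq_singleton.1 hf
    simp only [map_singleton, sum_singleton, mem_singleton, forall_eq] at *
    rcases hq₁.2 with hc | hc
    · refine (shrinkable_or_weightCount_le c hq).imp (fun h => h.mono ?_) fun h => h.trans ?_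
      · exact fun t ht => .push hr h₁ ht
      · exact (Nat.mul_le_mul_right B hc).trans (Nat.le_add_left _ _)
    · refine .inl (hc.sum_snd fun v hv hvL => ?_)
      exact .push hr hvL (Yields.sum_snd v fun q hqv => (hq q (mem_of_le hv hqv)).1)
  | @pop A i α hr =>
    intro Y π wt w hw
    refine single (by rw [hw]; exact .pop hr) (.inr ?_)
    have h1 := weightCount_le_card (wt := wt) w
    rw [← card_map π, hw, coe_card] at h1
    have := hCp A i α hr
    nlinarith

/-- The core together with the heaviest part for each letter makes up a fixed fraction. -/
theorem _root_.Shrinkable.exists_count_le {X Y T : Type*} [Fintype T] [DecidableEq T]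
    {K : ℕ} {L : Set (Multiset X)} {π : Y → X} {wt : Y → Multiset T} {w : Multiset Y}
    (h : Shrinkable (Fintype.card T) K L π wt w) :
    ∃ v ≤ w, v.map π ∈ L ∧ (v.map wt).sum < (w.map wt).sum ∧
      ∀ a, count a (w.map wt).sum ≤ (K + 1) * count a (v.map wt).sum := by
  obtain ⟨p, P, hK, h0, hs, h⟩ := h
  have hmax (a : T) : ∃ u, (P ≠ 0 → u ∈ P) ∧ ∀ x ∈ P, count a x ≤ count a u := by
    by_cases hP : P = 0
    · exact ⟨0, fun h => (h hP).elim, by simp [hP]⟩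
    · obtain ⟨u, hu, hmax⟩ := P.toFinset.exists_max_image (count a) (by simpa using hP)
      exact ⟨u, fun _ => by simpa using hu, fun x hx => hmax x (by simpa using hx)⟩
  choose u hu hmax using hmax
  have hP : P ≠ 0 := by
    rintro rfl
    obtain ⟨I, -, hI, -⟩ := h 0 le_rfl (by simp)
    exact absurd hI (not_lt_of_ge (zero_le _))
  obtain ⟨I, hJI, hI, v, hv, hvL, hvs⟩ := h (Finset.univ.image u).val
    ((le_iff_subset (Finset.nodup _)).2 fun x hx => by
      obtain ⟨a, -, rfl⟩ := Finset.mem_image.1 hx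
      exact hu a hP) Finset.card_image_le
  refine ⟨v, hv, hvL, ?_, fun a => ?_⟩
  · obtain ⟨R, rfl⟩ := exists_add_of_le hI.le
    rw [hvs, ← hs, sum_add, ← add_assoc]
    refine lt_of_le_of_ne (Multiset.le_add_right _ _) fun heq => ?_
    have hR : R.sum = 0 := by simpa using heq
    -- A missing part would have weight zero, which `0 ∉ P` forbids.
    obtain ⟨x, hx⟩ := exists_mem_of_ne_zero (s := R) (by rintro rfl; simp at hI)
    have hx0 := sum_eq_zero_iff.1 hR x hx
    exact h0 (mem_add.2 (.inr (hx0 ▸ hx)))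
  · have huI : u a ∈ I := mem_of_le hJI (Finset.mem_image_of_mem u (Finset.mem_univ a))
    have h1 : count a (u a) ≤ count a I.sum := count_le_of_le a (le_sum_of_mem huI)
    have h2 : count a P.sum ≤ K * count a (u a) := by
      have := le_card_mul_of_forall_mem_le (s := P.map (count a)) (b := count a (u a))
        (by simpa using hmax a)
      rw [card_map] at this
      calc count a P.sum = (P.map (count a)).sum := map_multiset_sum (countAddMonoidHom a) P
        _ ≤ _ := this.trans (Nat.mul_le_mul_right _ hK)
    rw [hvs, ← hs, count_add, count_add]
    nlinarith

end Shrinking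

end IndexedGrammar
-- Correspondence between `Yields` and derivations
theorem List.exists_perm_map_eq {α β : Type*} (f : α → β) {l : List α} {v : List β}
    (h : (l.map f).Perm v) : ∃ u, l.Perm u ∧ u.map f = v := by
  obtain ⟨u, rfl, hu⟩ := (congrFun₂ (List.eq_map_comp_perm f) v l).mpr h.symm
  exact ⟨u, hu.symm, rfl⟩

namespace IndexedGrammar

variable {T : Type*} {g : IndexedGrammar T}

section Soundness

theorem Derives.append {u v u' v' : IndexedForm T g.NT g.Index} (h : g.Derives u v)
    (h' : g.Derives u' v') : g.Derives (u ++ u') (v ++ v') := by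
  refine Relation.ReflTransGen.trans (b := v ++ u') ?_ ?_
  · refine Relation.ReflTransGen.lift (· ++ u') ?_ _ _ h
    rintro _ _ ⟨r, hr, A, δ, γ, p, q, hγ, rfl, rfl⟩
    exact ⟨r, hr, A, δ, γ, p, q ++ u', hγ, by simp, by simp⟩
  · refine Relation.ReflTransGen.lift (v ++ ·) ?_ _ _ h'
    rintro _ _ ⟨r, hr, A, δ, γ, p, q, hγ, rfl, rfl⟩
    exact ⟨r, hr, A, δ, γ, v ++ p, q, hγ, by simp, by simp⟩

/-- Rules act on one nonterminal regardless of context. This lets soundness work with multisets: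
`Yields.add` forgets how its summands interleave. -/
theorem Derives.exists_perm {u v u' : IndexedForm T g.NT g.Index} (h : g.Derives u v)
    (hu : u.Perm u') : ∃ v', v.Perm v' ∧ g.Derives u' v' := by
  induction h with
  | refl => exact ⟨u', hu, .refl⟩
  | tail _ hp ih =>
    obtain ⟨_, hv, hd⟩ := ih
    obtain ⟨r, hr, A, δ, γ, p, q, hγ, rfl, rfl⟩ := hp
    obtain ⟨p', q', rfl⟩ := List.append_of_mem
      (hv.subset (by simp : Symbol.nonterminal (A, δ) ∈ p ++ [.nonterminal (A, δ)] ++ q))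
    refine ⟨p' ++ γ ++ q', ?_, hd.tail ⟨r, hr, A, δ, γ, p', q', hγ, by simp, rfl⟩⟩
    have hpq : (p ++ q).Perm (p' ++ q') := List.perm_cons _ |>.1 <|
      (List.perm_middle.symm.trans (by simpa using hv)).trans List.perm_middle
    simp only [← Multiset.coe_eq_coe, ← Multiset.coe_add] at hpq ⊢
    rw [add_right_comm, hpq, add_right_comm]

theorem derives_of_rewrites {r : IndexedRule T g.NT g.Index} (hr : r ∈ g.rules) {A : g.NT}
    {δ : List g.Index} {γ : IndexedForm T g.NT g.Index} (h : r.Rewrites A δ γ) :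
    g.Derives [.nonterminal (A, δ)] γ :=
  .single ⟨r, hr, A, δ, γ, [], [], h, by simp, by simp⟩

theorem attach_append (δ : List g.Index) (u v : List (Symbol T g.NT)) :
    IndexedForm.attach δ (u ++ v) = IndexedForm.attach δ u ++ IndexedForm.attach δ v :=
  List.map_append

theorem Yields.exists_derives {f : Option g.Index} {s t : Multiset (Symbol T g.NT)}
    (h : g.Yields f s t) (δ : List g.Index) : ∀ u : List (Symbol T g.NT), (u : Multiset _) = s →
      ∃ v : List (Symbol T g.NT), (v : Multiset _) = t ∧
        g.Derives (IndexedForm.attach (f.toList ++ δ) u) (IndexedForm.attach δ v) := by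
  induction h generalizing δ with
  | zero f =>
    intro u hu
    rw [Multiset.coe_eq_zero] at hu
    subst hu
    exact ⟨[], rfl, .refl⟩
  | terminal f a =>
    intro u hu
    rw [Multiset.coe_eq_singleton] at hu
    subst hu
    exact ⟨[.terminal a], rfl, .refl⟩
  | @add f s₁ s₂ t₁ t₂ _ _ ih₁ ih₂ =>
    intro u hu
    obtain ⟨v₁, hv₁, hd₁⟩ := ih₁ δ s₁.toList (by simp)
    obtain ⟨v₂, hv₂, hd₂⟩ := ih₂ δ s₂.toList (by simp)
    have hp : (s₁.toList ++ s₂.toList).Perm u := by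
      rw [← Multiset.coe_eq_coe, hu, ← Multiset.coe_add, Multiset.coe_toList, Multiset.coe_toList]
    obtain ⟨v', hv', hd⟩ := (hd₁.append hd₂).exists_perm
      ((attach_append _ _ _ ▸ hp.map _ : List.Perm _ (IndexedForm.attach (f.toList ++ δ) u)))
    rw [← attach_append] at hv'
    obtain ⟨v, hv, rfl⟩ := List.exists_perm_map_eq _ hv'
    exact ⟨v, by rw [← Multiset.coe_eq_coe.2 hv, ← Multiset.coe_add, hv₁, hv₂], hd⟩
  | expand hr _ ih =>
    intro u hu
    obtain rfl := Multiset.coe_eq_singleton.1 hu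
    obtain ⟨v, hv, hd⟩ := ih δ _ rfl
    exact ⟨v, hv, (derives_of_rewrites hr (.expand _ _ _)).trans hd⟩
  | push hr _ _ ih₁ ih₂ =>
    intro u hu
    obtain rfl := Multiset.coe_eq_singleton.1 hu
    obtain ⟨v, hv, hd⟩ := ih₁ (_ ++ δ) _ rfl
    obtain ⟨v', hv', hd'⟩ := ih₂ δ v hv
    exact ⟨v', hv', ((derives_of_rewrites hr (.push _ _ _ _)).trans hd).trans hd'⟩
  | pop hr =>
    intro u hu
    obtain rfl := Multiset.coe_eq_singleton.1 hu
    exact ⟨_, rfl, derives_of_rewrites hr (.pop _ _ _ _)⟩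

end Soundness

section Completeness

/-- Rewriting a form all of whose nonterminals carry the index string `δ` to a terminal form. -/
def YieldsWord (g : IndexedGrammar T) :
    List g.Index → Multiset (Symbol T g.NT) → Multiset T → Prop
  | [], s, c => g.Yields none s (c.map .terminal)
  | f :: δ, s, c => ∃ t, g.Yields (some f) s t ∧ g.YieldsWord δ t c

theorem YieldsWord.zero (δ : List g.Index) : g.YieldsWord δ 0 0 := by
  induction δ with
  | nil => exact Yields.zero _
  | cons f δ ih => exact ⟨0, .zero _, ih⟩

theorem YieldsWord.terminal (δ : List g.Index) (a : T) : g.YieldsWord δ {.terminal a} {a} := by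
  induction δ with
  | nil => exact Yields.terminal _ a
  | cons f δ ih => exact ⟨_, .terminal _ a, ih⟩

theorem YieldsWord.add {δ : List g.Index} {s₁ s₂ : Multiset (Symbol T g.NT)} {c₁ c₂ : Multiset T}
    (h₁ : g.YieldsWord δ s₁ c₁) (h₂ : g.YieldsWord δ s₂ c₂) :
    g.YieldsWord δ (s₁ + s₂) (c₁ + c₂) := by
  induction δ generalizing s₁ s₂ with
  | nil =>
    rw [YieldsWord, Multiset.map_add]
    exact Yields.add h₁ h₂
  | cons f δ ih =>
    obtain ⟨t₁, ht₁, h₁⟩ := h₁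
    obtain ⟨t₂, ht₂, h₂⟩ := h₂
    exact ⟨_, ht₁.add ht₂, ih h₁ h₂⟩

/-- Rewriting an arbitrary sentential form, symbol by symbol, to a terminal form. -/
def FormYieldsWord (g : IndexedGrammar T) : IndexedForm T g.NT g.Index → Multiset T → Prop
  | [], c => c = 0
  | .terminal a :: u, c => ∃ c', c = {a} + c' ∧ g.FormYieldsWord u c'
  | .nonterminal (A, δ) :: u, c => ∃ c₁ c₂, c = c₁ + c₂ ∧
      g.YieldsWord δ {.nonterminal A} c₁ ∧ g.FormYieldsWord u c₂

theorem formYieldsWord_append {u v : IndexedForm T g.NT g.Index} {c : Multiset T} :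
    g.FormYieldsWord (u ++ v) c ↔
      ∃ c₁ c₂, c = c₁ + c₂ ∧ g.FormYieldsWord u c₁ ∧ g.FormYieldsWord v c₂ := by
  induction u generalizing c with
  | nil => simp [FormYieldsWord]
  | cons x u ih =>
    rcases x with a | ⟨A, δ⟩
    · simp only [List.cons_append, FormYieldsWord, ih]
      constructor
      · rintro ⟨_, rfl, c₁, c₂, rfl, h₁, h₂⟩
        exact ⟨_, _, (add_assoc _ _ _).symm, ⟨_, rfl, h₁⟩, h₂⟩
      · rintro ⟨_, c₂, rfl, ⟨c₁, rfl, h₁⟩, h₂⟩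
        exact ⟨_, add_assoc _ _ _, _, _, rfl, h₁, h₂⟩
    · simp only [List.cons_append, FormYieldsWord, ih]
      constructor
      · rintro ⟨c₀, _, rfl, h₀, c₁, c₂, rfl, h₁, h₂⟩
        exact ⟨_, _, (add_assoc _ _ _).symm, ⟨_, _, rfl, h₀, h₁⟩, h₂⟩
      · rintro ⟨_, c₂, rfl, ⟨c₀, c₁, rfl, h₀, h₁⟩, h₂⟩
        exact ⟨_, _, add_assoc _ _ _, h₀, _, _, rfl, h₁, h₂⟩

theorem FormYieldsWord.yieldsWord {δ : List g.Index} {α : List (Symbol T g.NT)} {c : Multiset T}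
    (h : g.FormYieldsWord (IndexedForm.attach δ α) c) : g.YieldsWord δ α c := by
  induction α generalizing c with
  | nil => obtain rfl : c = 0 := h; exact .zero δ
  | cons x α ih =>
    rw [← Multiset.cons_coe, ← Multiset.singleton_add]
    rcases x with a | A
    · obtain ⟨c', rfl, h⟩ := h
      exact (YieldsWord.terminal δ a).add (ih h)
    · obtain ⟨c₁, c₂, rfl, h₁, h₂⟩ := h
      exact h₁.add (ih h₂)

theorem formYieldsWord_terminals (w : List T) : g.FormYieldsWord (w.map .terminal) w := by
  induction w with
  | nil => rfl
  | cons a w ih => exact ⟨w, by simp, ih⟩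

/-- The index string is consumed one index at a time, so a rule is absorbed by the first layer of
`YieldsWord`; a pushed index adds a layer, which `Yields.push` merges with the next. -/
theorem YieldsWord.of_rewrites {r : IndexedRule T g.NT g.Index} (hr : r ∈ g.rules) {A : g.NT}
    {δ : List g.Index} {γ : IndexedForm T g.NT g.Index} (h : r.Rewrites A δ γ) {c : Multiset T}
    (hc : g.FormYieldsWord γ c) : g.YieldsWord δ {.nonterminal A} c := by
  cases h with
  | expand A α δ =>
    have := hc.yieldsWord
    cases δ with
    | nil => exact .expand hr this
    | cons f δ => exact this.imp fun t ht => ⟨.expand hr ht.1, ht.2⟩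
  | push A B f δ =>
    obtain ⟨c₁, _, rfl, ⟨t, ht, hc⟩, rfl⟩ := hc
    rw [add_zero]
    cases δ with
    | nil => exact .push hr ht hc
    | cons f δ => exact hc.imp fun t' ht' => ⟨.push hr ht ht'.1, ht'.2⟩
  | pop A f α δ => exact ⟨_, .pop hr, hc.yieldsWord⟩

theorem FormYieldsWord.of_produces {u v : IndexedForm T g.NT g.Index} (h : g.Produces u v)
    {c : Multiset T} (hc : g.FormYieldsWord v c) : g.FormYieldsWord u c := by
  obtain ⟨r, hr, A, δ, γ, p, q, hγ, rfl, rfl⟩ := h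
  simp only [formYieldsWord_append] at hc ⊢
  obtain ⟨_, c₃, rfl, ⟨c₁, c₂, rfl, h₁, h₂⟩, h₃⟩ := hc
  exact ⟨_, _, rfl, ⟨_, _, rfl, h₁, ⟨c₂, 0, (add_zero _).symm, .of_rewrites hr hγ h₂, rfl⟩⟩, h₃⟩

end Completeness

theorem yields_of_mem_language {w : List T} (h : w ∈ g.language) :
    g.Yields none {.nonterminal g.initial} ((w : Multiset T).map .terminal) := by
  have : g.FormYieldsWord [.nonterminal (g.initial, [])] w :=
    -- The derivation is read backwards from its terminal word.
    Relation.ReflTransGen.head_induction_on (motive := fun u _ => g.FormYieldsWord u w) h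
      (formYieldsWord_terminals w) fun h _ ih => ih.of_produces h
  obtain ⟨c₁, _, hc, h, rfl⟩ := this
  rw [hc, add_zero]
  exact h

theorem exists_mem_language_of_yields {c : Multiset T}
    (h : g.Yields none {.nonterminal g.initial} (c.map .terminal)) :
    ∃ w ∈ g.language, (w : Multiset T) = c := by
  obtain ⟨v, hv, hd⟩ := h.exists_derives [] [.nonterminal g.initial] rfl
  rw [← Multiset.coe_toList c, Multiset.map_coe, Multiset.coe_eq_coe] at hv
  obtain ⟨w, hw, rfl⟩ := List.exists_perm_map_eq _ hv.symm
  refine ⟨w, ?_, by rw [← Multiset.coe_eq_coe.2 hw, Multiset.coe_toList]⟩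
  have : IndexedForm.attach [] (w.map .terminal) =
    (w.map .terminal : IndexedForm T g.NT g.Index) := by simp [IndexedForm.attach]
  rw [this] at hd
  exact hd

end IndexedGrammar
-- The constant and the theorem
namespace IndexedGrammar

theorem exists_length_bound {T : Type*} (g : IndexedGrammar T) :
    ∃ C, (∀ A α, .expand A α ∈ g.rules → α.length ≤ C) ∧
      ∀ A i α, .pop A i α ∈ g.rules → α.length ≤ C := by
  let len : IndexedRule T g.NT g.Index → ℕ
    | .expand _ α => α.length
    | .push _ _ _ => 0
    | .pop _ _ α => α.length
  exact ⟨g.rules.sup len, fun A α h => Finset.le_sup (f := len) h,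
    fun A i α h => Finset.le_sup (f := len) h⟩

open Multiset in
theorem exists_shrink_bound.{u} {T : Type u} [Finite T] [DecidableEq T] (g : IndexedGrammar T) :
    ∃ k : ℕ, ∀ w ∈ g.language, k < w.length → ∃ v ∈ g.language,
      (v : Multiset T) < w ∧ ∀ a, count a (w : Multiset T) ≤ (k + 1) * count a (v : Multiset T) := by
  have := Fintype.ofFinite T
  have := g.finite_NT
  have := g.finite_Index
  have : Finite (Symbol T g.NT) := by
    have := Fintype.ofFinite g.NT
    infer_instance
  obtain ⟨B, hB⟩ := exists_card_bound_extension
    (fun p : Option g.Index × Symbol T g.NT => {t | g.Yields p.1 {p.2} t}) (Fintype.card T)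
  obtain ⟨C, hCe, hCp⟩ := g.exists_length_bound
  have hB' (f : Option g.Index) (x : Symbol T g.NT) (s) (hs : g.Yields f {x} s) (d) (hd : d ≤ s)
      (hm : card d ≤ Fintype.card T) :
      ∃ t, g.Yields f {x} t ∧ d ≤ t ∧ t ≤ s ∧ card t ≤ B + 1 := by
    obtain ⟨t, ht, hdt, hts, htB⟩ := hB (f, x) s hs d hd hm
    exact ⟨t, ht, hdt, hts, htB.trans B.le_succ⟩
  -- This is `K` with `B + 1` for `B`, which makes the bound at least `1`. It also exceeds the small
  -- case, so a longer word must be shrinkable.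
  refine ⟨C * (B + 1) + (B + 1) * (B + 1), fun w hw hlen => ?_⟩
  have key (c : Multiset T) : (c.map fun a => ({a} : Multiset T)).sum = c := sum_map_singleton c
  obtain ⟨w₀, hf, hs, hq⟩ := (yields_of_mem_language hw).exists_decomposition hB' (by omega) hCe hCp
    Symbol.terminal (fun a => ({a} : Multiset T)) w rfl
  obtain ⟨⟨x, c⟩, rfl, rfl⟩ := map_eq_singleton.1 hf
  simp only [map_singleton, sum_singleton, mem_singleton, forall_eq] at hs hq
  subst hs
  rcases hq.2 with h | h
  · have : weightCount (fun a => ({a} : Multiset T)) (w : Multiset T) = w.length :=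
      weightCount_eq_card fun _ _ => singleton_ne_zero _
    nlinarith
  · obtain ⟨v, hv, hvL, hlt, hle⟩ := h.exists_count_le
    rw [key, key] at hlt
    simp only [key] at hle
    obtain ⟨v', hv', rfl⟩ := exists_mem_language_of_yields hvL
    exact ⟨v', hv', hlt, hle⟩

end IndexedGrammar

theorem corollary2 {T : Type*} [Finite T] [DecidableEq T] (L : Language T) (hL : L.IsIndexed) :
    ∃ k : ℕ, 0 < k ∧ ∀ w ∈ L, k < w.length →
      ∃ v ∈ L,
        (∀ a : T, (1 / (k : ℝ)) * (w.count a : ℝ) ≤ (v.count a : ℝ) ∧ v.count a ≤ w.count a) ∧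
        ∃ a : T, v.count a < w.count a := by
  obtain ⟨g, rfl⟩ := hL
  have := Fintype.ofFinite T
  obtain ⟨k, hk⟩ := g.exists_shrink_bound
  -- The factor lost is `k + 1`; raising the length threshold to it is harmless.
  refine ⟨k + 1, k.succ_pos, fun w hw hlen => ?_⟩
  obtain ⟨v, hv, hlt, hle⟩ := hk w hw (by omega)
  have hcount := Multiset.le_iff_count.1 hlt.le
  simp only [Multiset.coe_count] at hcount hle
  refine ⟨v, hv, fun a => ⟨?_, hcount a⟩, ?_⟩
  · rw [one_div, inv_mul_le_iff₀ (by positivity)]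
    exact_mod_cast hle a
  · by_contra! h
    exact hlt.not_ge (Multiset.le_iff_count.2 (by simpa using h))
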